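/- **Theorem 1.2** (trace theorem with a non-local derivative, half line). *Notation.* $\mathbb R_+=(0,\infty)$. - For $\phi:\mathbb R_+\to\mathbb R_+$ put $s_\phi(\lambda)=\sup_{t>0}\phi(\lambda t)/\phi(t)\in(0,\infty]$. For $a,b\in\mathbb R$, $\mathcal I_o(a,b)$ is the class of all $\phi:\mathbb R_+\to\mathbb R_+$ with $s_\phi(\lambda)=o(\lambda^a)$ as $\lambda\to0$ and $s_\phi(\lambda)=o(\lambda^b)$ as $\lambda\to\infty$. - For $p\in(1,\infty)$, $A_p$ is the class of measurable weights $w:\mathbb R\to[0,\infty)$, positive almost everywhere, with $$[w]_{A_p}=\sup_{a<b}\Big(\frac1{b-a}\int_a^b w\,dt\Big)\Big(\frac1{b-a}\int_a^b w^{-\frac1{p-1}}\,dt\Big)^{p-1}<\infty,$$ and $W(t)=\int_0^t w(s)\,ds$. - For $\kappa:\mathbb R_+\to\mathbb R_+$ decreasing (not necessarily strictly), $\kappa^{-1}(\lambda)=\inf\{s>0:\kappa(s)\le\lambda\}$ and $\kappa^*(t)=\kappa^{-1}(1/t)$. - $(X_0,X_1)$ is an interpolation couple: two Banach spaces continuously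 embedded in the same Hausdorff topological vector space. $X_0+X_1$ has the norm $\inf\{\|a_0\|_{X_0}+\|a_1\|_{X_1}: a=a_0+a_1\}$, and $K(t,a)=\inf\{\|a_0\|_{X_0}+t\|a_1\|_{X_1}:a=a_0+a_1,\ a_0\in X_0,\ a_1\in X_1\}$. The space $(X_0,X_1)_{\phi,p}$ consists of all $a\in X_0+X_1$ with $$\|a\|_{(X_0,X_1)_{\phi,p}}=\Big(\int_0^\infty\big(\phi(t^{-1})K(t,a)\big)^p\,\frac{dt}{t}\Big)^{1/p}<\infty.$$ - $L_p(\mathbb R_+,w\,dt;X)$ is the space of strongly measurable $g:\mathbb R_+\to X$ with $\|g\|=\big(\int_0^\infty\|g(t)\|_X^p\,w(t)\,dt\big)^{1/p}<\infty$. *Statement.* Let $p\in(1,\infty)$, let $w\in A_p$, and let $\kappa:\mathbb R_+\to\mathbb R_+$ be right-continuous and decreasing with $\kappa\in\mathcal I_o(-1,0)$. Suppose that $W\circ\kappa^*\in\mathcal I_o(0,p)$, $u\in L_p(\mathbb R_+,w\,dt;X_0)$, $f\in L_p(\mathbb R_+,w\,dt;X_1)$, $u_0\in X_0+X_1$, and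 $$\int_0^t\kappa(t-s)\,(u(s)-u_0)\,ds=\int_0^t f(s)\,ds\quad\text{in }X_0+X_1,\text{ for almost every }t\in\mathbb R_+$$ (Bochner integrals; those on the left converge absolutely for almost every $t$). Then $u_0\in(X_0,X_1)_{(W\circ\kappa^*)^{1/p},p}$ and $$\|u_0\|_{(X_0,X_1)_{(W\circ\kappa^*)^{1/p},p}}\le N\Big(\|u\|_{L_p(\mathbb R_+,w\,dt;X_0)}+\|f\|_{L_p(\mathbb R_+,w\,dt;X_1)}\Big).$$ Here the constant $N>0$ depends only on $p$, $\kappa$ and an upper bound $M$ for $[w]_{A_p}$. -/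

import Mathlib

open MeasureTheory Set Filter Topology
open scoped NNReal ENNReal

set_option linter.unusedSectionVars false

noncomputable section

namespace VolterraTrace

/-! ### Functions of class `I_o(a, b)` on `(0, ∞)` -/

/-- The dilation function `s_φ(r) = sup_{t > 0} φ(r t) / φ(t)`, with values in `[0, ∞]`.
Only the values of `φ` on `(0, ∞)` matter. -/
def dilationSup (φ : ℝ → ℝ) (r : ℝ) : ℝ≥0∞ :=
  ⨆ (t : ℝ) (_ : 0 < t), ENNReal.ofReal (φ (r * t) / φ t)

/-- `φ ∈ I_o(a, b)`: `φ` maps `(0, ∞)` to `(0, ∞)`, `s_φ(r) = o(r ^ a)` as `r → 0+` and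
`s_φ(r) = o(r ^ b)` as `r → ∞`. -/
structure IsClassIo (a b : ℝ) (φ : ℝ → ℝ) : Prop where
  pos : ∀ t : ℝ, 0 < t → 0 < φ t
  isLittleO_zero :
    Tendsto (fun r : ℝ => dilationSup φ r / ENNReal.ofReal (r ^ a)) (𝓝[>] 0) (𝓝 0)
  isLittleO_top :
    Tendsto (fun r : ℝ => dilationSup φ r / ENNReal.ofReal (r ^ b)) atTop (𝓝 0)

/-- The generalized inverse `κ⁻¹(r) = inf {s > 0 : κ(s) ≤ r}` of a decreasing function on
`(0, ∞)`. -/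
def genInv (κ : ℝ → ℝ) (r : ℝ) : ℝ :=
  sInf {s : ℝ | 0 < s ∧ κ s ≤ r}

/-- `κ*(t) = κ⁻¹(1 / t)`. -/
def kStar (κ : ℝ → ℝ) (t : ℝ) : ℝ :=
  genInv κ (1 / t)

/-! ### Muckenhoupt weights and weighted `L_p` spaces -/

/-- The Muckenhoupt constant `[w]_{A_p}` over all compact intervals of the real line, with values
in `[0, ∞]`; a negative power of `0` is `∞`. -/
def apConst (p : ℝ) (w : ℝ → ℝ≥0) : ℝ≥0∞ :=
  ⨆ (a : ℝ) (b : ℝ) (_ : a < b),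
    ((∫⁻ t in Icc a b, (w t : ℝ≥0∞)) / ENNReal.ofReal (b - a)) *
      ((∫⁻ t in Icc a b, (w t : ℝ≥0∞) ^ (-(1 / (p - 1)))) / ENNReal.ofReal (b - a)) ^ (p - 1)

/-- `w ∈ A_p(ℝ)`. The clause on positivity rules out nothing but the function that vanishes almost
everywhere, for which the products in `apConst` are of the form `0 * ∞`. -/
structure IsMuckenhoupt (p : ℝ) (w : ℝ → ℝ≥0) : Prop where
  measurable : Measurable w
  ae_pos : ∀ᵐ t, 0 < w t
  apConst_lt_top : apConst p w < ∞

/-- `W(t) = ∫_0^t w(s) ds`. -/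
def primitive (w : ℝ → ℝ≥0) (t : ℝ) : ℝ :=
  ∫ s in (0 : ℝ)..t, (w s : ℝ)

/-- The measure `w dt` on `(0, ∞)`; the space `L_p(ℝ_+, w dt; X)` is described by `MemLp` and
`eLpNorm` with respect to it. -/
def halfLineMeasure (w : ℝ → ℝ≥0) : Measure ℝ :=
  (volume.restrict (Ioi 0)).withDensity (fun t => (w t : ℝ≥0∞))

/-! ### Interpolation couples and generalized real interpolation -/

/-- An interpolation couple: two normed spaces embedded continuously and injectively into the same
topological vector space `Z`, which is assumed to be Hausdorff below. The spaces are real; a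
complex couple is one by restriction of scalars. -/
structure InterpolationCouple (X₀ X₁ Z : Type*)
    [NormedAddCommGroup X₀] [NormedSpace ℝ X₀] [NormedAddCommGroup X₁] [NormedSpace ℝ X₁]
    [AddCommGroup Z] [Module ℝ Z] [TopologicalSpace Z] where
  /-- the embedding of the first space -/
  i₀ : X₀ →L[ℝ] Z
  /-- the embedding of the second space -/
  i₁ : X₁ →L[ℝ] Z
  injective_i₀ : Function.Injective i₀
  injective_i₁ : Function.Injective i₁

namespace InterpolationCouple

variable {X₀ X₁ Z : Type*}
  [NormedAddCommGroup X₀] [NormedSpace ℝ X₀] [NormedAddCommGroup X₁] [NormedSpace ℝ X₁]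
  [AddCommGroup Z] [Module ℝ Z] [TopologicalSpace Z] [IsTopologicalAddGroup Z]
  [ContinuousSMul ℝ Z] [T2Space Z]

/-- The map `(a₀, a₁) ↦ a₀ + a₁` into `Z`, on `X₀ × X₁` with the norm `‖a₀‖ + ‖a₁‖`. -/
def addMap (c : InterpolationCouple X₀ X₁ Z) : WithLp 1 (X₀ × X₁) →L[ℝ] Z :=
  (c.i₀.coprod c.i₁).comp
    (WithLp.prodContinuousLinearEquiv 1 ℝ X₀ X₁ : WithLp 1 (X₀ × X₁) →L[ℝ] X₀ × X₁)

/-- The pairs `(a₀, a₁)` with `a₀ + a₁ = 0` in `Z`. -/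
def addKer (c : InterpolationCouple X₀ X₁ Z) : Submodule ℝ (WithLp 1 (X₀ × X₁)) :=
  LinearMap.ker (c.addMap : WithLp 1 (X₀ × X₁) →ₗ[ℝ] Z)

instance isClosed_addKer (c : InterpolationCouple X₀ X₁ Z) :
    IsClosed (c.addKer : Set (WithLp 1 (X₀ × X₁))) :=
  c.addMap.isClosed_ker

/-- The space `X₀ + X₁` with the norm `inf {‖a₀‖ + ‖a₁‖ : a = a₀ + a₁}`, realized as the quotient
of `X₀ × X₁` with the norm `‖a₀‖ + ‖a₁‖` by the pairs with sum zero. Its image in `Z`, and its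
norm, are identified by `toAmbient_injective`, `range_toAmbient` and `norm_eq` below. -/
abbrev SumSpace (c : InterpolationCouple X₀ X₁ Z) : Type _ :=
  WithLp 1 (X₀ × X₁) ⧸ c.addKer

/-- The inclusion of `X₀` in `X₀ + X₁`. -/
def inl (c : InterpolationCouple X₀ X₁ Z) (a : X₀) : c.SumSpace :=
  Submodule.Quotient.mk (WithLp.toLp 1 (a, 0))

/-- The inclusion of `X₁` in `X₀ + X₁`. -/
def inr (c : InterpolationCouple X₀ X₁ Z) (a : X₁) : c.SumSpace :=
  Submodule.Quotient.mk (WithLp.toLp 1 (0, a))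

/-- The inclusion of `X₀ + X₁` in `Z`. -/
def toAmbient (c : InterpolationCouple X₀ X₁ Z) : c.SumSpace →ₗ[ℝ] Z :=
  c.addKer.liftQ (c.addMap : WithLp 1 (X₀ × X₁) →ₗ[ℝ] Z) le_rfl

theorem toAmbient_injective (c : InterpolationCouple X₀ X₁ Z) :
    Function.Injective c.toAmbient := by
  rw [← LinearMap.ker_eq_bot]
  exact Submodule.ker_liftQ_eq_bot _ _ _ le_rfl

theorem toAmbient_inl_add_inr (c : InterpolationCouple X₀ X₁ Z) (a₀ : X₀) (a₁ : X₁) :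
    c.toAmbient (c.inl a₀ + c.inr a₁) = c.i₀ a₀ + c.i₁ a₁ := by
  simp [toAmbient, inl, inr, addMap]

theorem range_toAmbient (c : InterpolationCouple X₀ X₁ Z) :
    range c.toAmbient = {z | ∃ a₀ a₁, z = c.i₀ a₀ + c.i₁ a₁} := by
  ext z
  constructor
  · rintro ⟨a, rfl⟩
    obtain ⟨q, rfl⟩ := Submodule.Quotient.mk_surjective _ a
    exact ⟨q.fst, q.snd, by simp [toAmbient, addMap]⟩
  · rintro ⟨a₀, a₁, rfl⟩
    exact ⟨_, c.toAmbient_inl_add_inr a₀ a₁⟩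

theorem mk_eq_inl_add_inr (c : InterpolationCouple X₀ X₁ Z) (q : WithLp 1 (X₀ × X₁)) :
    (Submodule.Quotient.mk q : c.SumSpace) = c.inl q.fst + c.inr q.snd := by
  apply c.toAmbient_injective
  rw [toAmbient_inl_add_inr]
  simp [toAmbient, addMap]

theorem norm_eq (c : InterpolationCouple X₀ X₁ Z) (a : c.SumSpace) :
    ‖a‖ = sInf {r : ℝ | ∃ a₀ a₁, a = c.inl a₀ + c.inr a₁ ∧ r = ‖a₀‖ + ‖a₁‖} := by
  have hset : {r : ℝ | ∃ a₀ a₁, a = c.inl a₀ + c.inr a₁ ∧ r = ‖a₀‖ + ‖a₁‖}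
      = norm '' {q : WithLp 1 (X₀ × X₁) | (Submodule.Quotient.mk q : c.SumSpace) = a} := by
    ext r
    constructor
    · rintro ⟨a₀, a₁, rfl, rfl⟩
      exact ⟨WithLp.toLp 1 (a₀, a₁), c.mk_eq_inl_add_inr _, WithLp.prod_norm_eq_of_L1 _⟩
    · rintro ⟨q, rfl, rfl⟩
      exact ⟨q.fst, q.snd, c.mk_eq_inl_add_inr q, WithLp.prod_norm_eq_of_L1 _⟩
  obtain ⟨q, hq⟩ := Submodule.Quotient.mk_surjective _ a
  rw [hset]
  apply le_antisymm
  · refine le_csInf ⟨‖q‖, q, hq, rfl⟩ ?_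
    rintro _ ⟨q', rfl, rfl⟩
    exact Submodule.Quotient.norm_mk_le c.addKer q'
  · apply le_of_forall_pos_le_add
    intro ε hε
    obtain ⟨q', hq', hlt⟩ := Submodule.Quotient.norm_mk_lt a hε
    refine le_trans (csInf_le ⟨0, ?_⟩ ⟨q', hq', rfl⟩) hlt.le
    rintro _ ⟨_, -, rfl⟩
    exact norm_nonneg _

/-- The `K`-functional
`K(t, a; X₀, X₁) = inf {‖a₀‖ + t ‖a₁‖ : a = a₀ + a₁, a₀ ∈ X₀, a₁ ∈ X₁}`. -/
def kFunctional (c : InterpolationCouple X₀ X₁ Z) (t : ℝ) (a : c.SumSpace) : ℝ≥0∞ :=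
  ⨅ (a₀ : X₀) (a₁ : X₁) (_ : a = c.inl a₀ + c.inr a₁), ENNReal.ofReal (‖a₀‖ + t * ‖a₁‖)

/-- The norm of `(X₀, X₁)_{φ, p}` for `1 ≤ p < ∞`, namely
`(∫_0^∞ (φ(1/t) K(t, a; X₀, X₁)) ^ p dt / t) ^ (1 / p)`, with values in `[0, ∞]`. -/
def interpNorm (c : InterpolationCouple X₀ X₁ Z) (φ : ℝ → ℝ) (p : ℝ) (a : c.SumSpace) : ℝ≥0∞ :=
  (∫⁻ t in Ioi (0 : ℝ),
    (ENNReal.ofReal (φ t⁻¹) * c.kFunctional t a) ^ p * ENNReal.ofReal t⁻¹) ^ (1 / p)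

/-- The generalized real interpolation space `(X₀, X₁)_{φ, p}`, a subset of `X₀ + X₁`. -/
def interpSpace (c : InterpolationCouple X₀ X₁ Z) (φ : ℝ → ℝ) (p : ℝ) : Set c.SumSpace :=
  {a | c.interpNorm φ p a < ∞}

end InterpolationCouple

end VolterraTrace

end

namespace VolterraTrace

/-! At a time `t` where the equation holds, it reads `m u₀ = ∫_0^t κ(t-s) u(s) ds - ∫_0^t f ds` with
`m = ∫_0^t κ`. This splits `u₀` between `X₀` and `X₁`. Averaging over `t ∈ (T, 2T]` yields a `t` at
which the convolution is `≲ κ(T) ∫_0^{2T} ‖u‖`, because `∫_0^{2T} κ ≲ T κ(T)`. By doubling, also `m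
≳ T κ(T)`. Hence `K(κ(T), u₀) ≲ T⁻¹ ∫_0^{2T} (‖u‖ + ‖f‖)`, which is `kFunctional_le_lintegral`.

Now cut the integral in the interpolation norm at the levels `κ(2^n)`. For `l` between `κ(2^(n+1))`
and `κ(2^n)` one has `κ⁻¹(l) ≤ 2^(n+1)` and `K(l) ≤ K(κ(2^n))`, while the `dl/l`-mass is bounded by
doubling of `κ`. So the norm is controlled by `∑ W(2^(n+1)) K(κ(2^n), u₀)^p` (`rpow_interpNorm_le`).

With the pointwise bound this becomes the left side of a dyadic Hardy inequality (`exists_hardy`).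
That inequality holds for `A_p` weights because the dual weight `w^(-1/(p-1))` is reverse doubling:
the shells `(2^(n-k), 2^(n-k+1)]` contribute with geometric decay in `k`. -/

/-! ### Hölder's inequality and `A_p` weights on `(0, t]`. -/

theorem rpow_lintegral_le_mul_rpow {α : Type*} [MeasurableSpace α] {μ : Measure α} {p : ℝ}
    (hp : 1 < p) {w : α → ℝ≥0} (hw : Measurable w) (hpos : ∀ᵐ x ∂μ, 0 < w x)
    {g : α → ℝ≥0∞} (hg : AEMeasurable g μ) :
    (∫⁻ x, g x ∂μ) ^ p ≤ (∫⁻ x, g x ^ p * w x ∂μ) *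
      (∫⁻ x, (w x : ℝ≥0∞) ^ (-(1 / (p - 1))) ∂μ) ^ (p - 1) := by
  have hp0 : 0 < p := by linarith
  have hp1 : 0 < p - 1 := by linarith
  have hpq : p.HolderConjugate (p / (p - 1)) := Real.HolderConjugate.conjExponent hp
  have hwm : Measurable fun x => (w x : ℝ≥0∞) := hw.coe_nnreal_ennreal
  -- Hölder for `g = (g w^(1/p)) · w^(-1/p)`.
  have key := ENNReal.lintegral_mul_le_Lp_mul_Lq μ hpq
    (f := fun x => g x * (w x : ℝ≥0∞) ^ (1 / p)) (g := fun x => (w x : ℝ≥0∞) ^ (-(1 / p)))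
    (hg.mul (hwm.pow_const _).aemeasurable) (hwm.pow_const _).aemeasurable
  have h1 : ∫⁻ x, ((fun x => g x * (w x : ℝ≥0∞) ^ (1 / p)) *
      fun x => (w x : ℝ≥0∞) ^ (-(1 / p))) x ∂μ = ∫⁻ x, g x ∂μ := by
    refine lintegral_congr_ae ?_
    filter_upwards [hpos] with x hx
    have hx0 : (w x : ℝ≥0∞) ≠ 0 := by exact_mod_cast hx.ne'
    simp only [Pi.mul_apply]
    rw [mul_assoc, ← ENNReal.rpow_add _ _ hx0 ENNReal.coe_ne_top]
    simp
  have h2 : ∫⁻ x, (g x * (w x : ℝ≥0∞) ^ (1 / p)) ^ p ∂μ = ∫⁻ x, g x ^ p * w x ∂μ := by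
    refine lintegral_congr fun x => ?_
    rw [ENNReal.mul_rpow_of_nonneg _ _ hp0.le, ← ENNReal.rpow_mul, one_div_mul_cancel hp0.ne',
      ENNReal.rpow_one]
  have h3 : ∫⁻ x, ((w x : ℝ≥0∞) ^ (-(1 / p))) ^ (p / (p - 1)) ∂μ =
      ∫⁻ x, (w x : ℝ≥0∞) ^ (-(1 / (p - 1))) ∂μ := by
    refine lintegral_congr fun x => ?_
    rw [← ENNReal.rpow_mul]
    congr 1
    field_simp
  rw [h1, h2, h3] at key
  calc (∫⁻ x, g x ∂μ) ^ p ≤ _ := ENNReal.rpow_le_rpow key hp0.le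
    _ = _ := by
      rw [ENNReal.mul_rpow_of_nonneg _ _ hp0.le, ← ENNReal.rpow_mul, ← ENNReal.rpow_mul,
        one_div_mul_cancel hp0.ne', ENNReal.rpow_one]
      congr 2
      field_simp

theorem lintegral_mul_rpow_le_of_apConst_le {p : ℝ} (hp : 1 < p) {w : ℝ → ℝ≥0} {M : ℝ≥0}
    (hM : apConst p w ≤ M) {t : ℝ} (ht : 0 < t) :
    (∫⁻ s in Ioc 0 t, (w s : ℝ≥0∞)) *
      (∫⁻ s in Ioc 0 t, (w s : ℝ≥0∞) ^ (-(1 / (p - 1)))) ^ (p - 1) ≤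
      M * ENNReal.ofReal t ^ p := by
  have hp1 : 0 < p - 1 := by linarith
  have ht0 : ENNReal.ofReal t ≠ 0 := by simpa using ht
  have ht' : ENNReal.ofReal t ≠ ∞ := ENNReal.ofReal_ne_top
  have h := (le_iSup₂_of_le 0 t (le_iSup_of_le ht le_rfl)).trans hM
  rw [sub_zero, ← Measure.restrict_congr_set (Ioc_ae_eq_Icc (μ := volume)),
    ENNReal.div_rpow_of_nonneg _ _ hp1.le] at h
  set A := ∫⁻ s in Ioc 0 t, (w s : ℝ≥0∞)
  set B := (∫⁻ s in Ioc 0 t, (w s : ℝ≥0∞) ^ (-(1 / (p - 1)))) ^ (p - 1)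
  set τ := ENNReal.ofReal t
  have hτ : τ ^ p = τ * τ ^ (p - 1) := by
    conv_rhs => rw [← ENNReal.rpow_one τ]
    rw [← ENNReal.rpow_mul, ← ENNReal.rpow_add _ _ ht0 ht']
    congr 1; ring
  have h1 : τ ^ (p - 1) ≠ 0 := by simp [ht0, ht']
  have h2 : τ ^ (p - 1) ≠ ∞ := ENNReal.rpow_ne_top_of_nonneg hp1.le ht'
  calc A * B = (A / τ * τ) * (B / τ ^ (p - 1) * τ ^ (p - 1)) := by
        rw [ENNReal.div_mul_cancel ht0 ht', ENNReal.div_mul_cancel h1 h2]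
    _ = (A / τ * (B / τ ^ (p - 1))) * τ ^ p := by rw [hτ]; ring
    _ ≤ M * τ ^ p := by gcongr

theorem lintegral_Ioc_pos {h : ℝ → ℝ≥0∞} (hm : Measurable h) (hpos : ∀ᵐ t, 0 < h t) {a b : ℝ}
    (hab : a < b) : 0 < ∫⁻ s in Ioc a b, h s := by
  rw [setLIntegral_pos_iff hm]
  have : (Function.support h ∩ Ioc a b : Set ℝ) =ᵐ[volume] (Ioc a b : Set ℝ) := by
    filter_upwards [hpos] with x hx
    refine propext ⟨fun h => h.2, fun hx' => ⟨hx.ne', hx'⟩⟩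
  rw [measure_congr this, Real.volume_Ioc]
  simpa using hab

section Weight

variable {p : ℝ} {w : ℝ → ℝ≥0} {M : ℝ≥0}

theorem IsMuckenhoupt.lintegral_pos (hw : IsMuckenhoupt p w) {a b : ℝ} (hab : a < b) :
    0 < ∫⁻ s in Ioc a b, (w s : ℝ≥0∞) :=
  lintegral_Ioc_pos hw.measurable.coe_nnreal_ennreal
    (hw.ae_pos.mono fun t ht => by exact_mod_cast ht) hab

theorem IsMuckenhoupt.lintegral_dual_pos (hp : 1 < p) (hw : IsMuckenhoupt p w) {a b : ℝ}
    (hab : a < b) : 0 < ∫⁻ s in Ioc a b, (w s : ℝ≥0∞) ^ (-(1 / (p - 1))) := by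
  have hp1 : 0 < p - 1 := by linarith
  refine lintegral_Ioc_pos (hw.measurable.coe_nnreal_ennreal.pow_const _)
    (Eventually.of_forall fun t => ?_) hab
  -- A negative power vanishes only at `∞`, and `w` is finite everywhere.
  rw [pos_iff_ne_zero, Ne, ENNReal.rpow_eq_zero_iff]
  simp [hp.le]

/-- The dual factor in the `A_p` product is positive, so an infinite integral of `w` would make the
product infinite. -/
theorem IsMuckenhoupt.lintegral_ne_top (hp : 1 < p) (hw : IsMuckenhoupt p w) (t : ℝ) :
    ∫⁻ s in Ioc 0 t, (w s : ℝ≥0∞) ≠ ∞ := by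
  rcases le_or_gt t 0 with ht | ht
  · simp [Ioc_eq_empty_of_le ht]
  intro h
  have := lintegral_mul_rpow_le_of_apConst_le hp
    (ENNReal.coe_toNNReal hw.apConst_lt_top.ne).ge ht
  rw [h, ENNReal.top_mul (ENNReal.rpow_pos_of_nonneg (hw.lintegral_dual_pos hp ht)
    (by linarith)).ne', top_le_iff] at this
  exact ENNReal.mul_ne_top ENNReal.coe_ne_top
    (ENNReal.rpow_ne_top_of_nonneg (by linarith) ENNReal.ofReal_ne_top) this

theorem IsMuckenhoupt.lintegral_dual_ne_top (hp : 1 < p) (hw : IsMuckenhoupt p w) (t : ℝ) :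
    ∫⁻ s in Ioc 0 t, (w s : ℝ≥0∞) ^ (-(1 / (p - 1))) ≠ ∞ := by
  rcases le_or_gt t 0 with ht | ht
  · simp [Ioc_eq_empty_of_le ht]
  intro h
  have := lintegral_mul_rpow_le_of_apConst_le hp
    (ENNReal.coe_toNNReal hw.apConst_lt_top.ne).ge ht
  rw [h, ENNReal.top_rpow_of_pos (by linarith), ENNReal.mul_top (hw.lintegral_pos ht).ne',
    top_le_iff] at this
  exact ENNReal.mul_ne_top ENNReal.coe_ne_top
    (ENNReal.rpow_ne_top_of_nonneg (by linarith) ENNReal.ofReal_ne_top) this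

/-- Reverse doubling of the dual weight, with a ratio that depends on `p` and `M` only. -/
theorem exists_dual_reverse_doubling (hp : 1 < p) (M : ℝ≥0) :
    ∃ ρ : ℝ≥0, ρ < 1 ∧ ∀ w : ℝ → ℝ≥0, IsMuckenhoupt p w → apConst p w ≤ M → ∀ t : ℝ, 0 < t →
      ∫⁻ s in Ioc 0 t, (w s : ℝ≥0∞) ^ (-(1 / (p - 1))) ≤
        ρ * ∫⁻ s in Ioc 0 (2 * t), (w s : ℝ≥0∞) ^ (-(1 / (p - 1))) := by
  have hp0 : 0 < p := by linarith
  have hp1 : 0 < p - 1 := by linarith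
  -- `D` is the constant in `A + B ≤ D B` below, for the dual masses `A` of `(0, t]` and `B` of `(t,
  -- 2t]`. Then `A ≤ (1 - D⁻¹)(A + B)`; the summand 1 ensures `D ≥ 1`.
  set D : ℝ≥0 := (M * 2 ^ p) ^ (1 / (p - 1)) + 1 with hD
  have hD0 : 0 < D := by positivity
  refine ⟨1 - D⁻¹, tsub_lt_self one_pos (inv_pos.2 hD0), fun w hw hM t ht => ?_⟩
  set A := ∫⁻ s in Ioc 0 t, (w s : ℝ≥0∞) ^ (-(1 / (p - 1))) with hA
  set B := ∫⁻ s in Ioc t (2 * t), (w s : ℝ≥0∞) ^ (-(1 / (p - 1))) with hB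
  set V := ∫⁻ s in Ioc 0 (2 * t), (w s : ℝ≥0∞) with hV
  have hAB : ∫⁻ s in Ioc 0 (2 * t), (w s : ℝ≥0∞) ^ (-(1 / (p - 1))) = A + B := by
    rw [← Ioc_union_Ioc_eq_Ioc ht.le (by linarith : t ≤ 2 * t),
      lintegral_union measurableSet_Ioc (Ioc_disjoint_Ioc_of_le le_rfl)]
  have hfin : A + B ≠ ∞ := hAB ▸ hw.lintegral_dual_ne_top hp _
  have h1 := lintegral_mul_rpow_le_of_apConst_le hp hM (by linarith : 0 < 2 * t)
  rw [hAB, ← hV] at h1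
  -- Hölder with `g = 1` bounds `t^p` by the mass of `w` on `(t, 2t]` times `B^(p-1)`. Combined with
  -- the `A_p` bound on `(0, 2t]`, the mass `V` cancels.
  have h2 := rpow_lintegral_le_mul_rpow (μ := volume.restrict (Ioc t (2 * t))) hp hw.measurable
    (ae_restrict_of_ae hw.ae_pos) (g := fun _ => 1) aemeasurable_const
  simp only [lintegral_const, ENNReal.one_rpow, one_mul, Measure.restrict_apply MeasurableSet.univ,
    univ_inter, Real.volume_Ioc] at h2
  rw [show 2 * t - t = t by ring, ← hB] at h2
  have h3 : ∫⁻ s in Ioc t (2 * t), (w s : ℝ≥0∞) ≤ V :=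
    lintegral_mono_set (Ioc_subset_Ioc_left ht.le)
  have hV0 : V ≠ 0 := (hw.lintegral_pos (by linarith)).ne'
  have hVt : V ≠ ∞ := hw.lintegral_ne_top hp _
  have h4 : (A + B) ^ (p - 1) ≤ (M * 2 ^ p : ℝ≥0) * B ^ (p - 1) := by
    refine (ENNReal.mul_le_mul_iff_right hV0 hVt).1 ?_
    calc V * (A + B) ^ (p - 1) ≤ M * ENNReal.ofReal (2 * t) ^ p := h1
      _ = M * 2 ^ p * ENNReal.ofReal t ^ p := by
        rw [ENNReal.ofReal_mul zero_le_two, ENNReal.mul_rpow_of_nonneg _ _ hp0.le, mul_assoc,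
          ENNReal.ofReal_ofNat]
      _ ≤ M * 2 ^ p * (V * B ^ (p - 1)) := by gcongr; exact h2.trans (by gcongr)
      _ = V * ((M * 2 ^ p : ℝ≥0) * B ^ (p - 1)) := by
        rw [ENNReal.coe_mul, ENNReal.coe_rpow_of_nonneg _ hp0.le, ENNReal.coe_ofNat]; ring
  have h5 : A + B ≤ D * B := by
    have := ENNReal.rpow_le_rpow h4 (by positivity : 0 ≤ 1 / (p - 1))
    rw [ENNReal.mul_rpow_of_nonneg _ _ (by positivity), ← ENNReal.rpow_mul, ← ENNReal.rpow_mul,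
      mul_one_div_cancel hp1.ne', ENNReal.rpow_one, ENNReal.rpow_one,
      ← ENNReal.coe_rpow_of_nonneg _ (by positivity)] at this
    refine this.trans ?_
    gcongr
    simp [hD]
  rw [hAB]
  clear_value A B
  lift A to ℝ≥0 using (ENNReal.add_ne_top.1 hfin).1
  lift B to ℝ≥0 using (ENNReal.add_ne_top.1 hfin).2
  norm_cast at h5 ⊢
  rw [← NNReal.coe_le_coe] at h5 ⊢
  have hD1 : D⁻¹ ≤ 1 := inv_le_one_of_one_le₀ (by simp [hD])
  push_cast [NNReal.coe_sub hD1] at h5 ⊢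
  have hD0' : (0 : ℝ) < D := hD0
  rw [← mul_le_mul_iff_right₀ hD0']
  have : (D : ℝ) * ((1 - (D : ℝ)⁻¹) * (A + B)) = D * (A + B) - (A + B) := by
    field_simp
  rw [this]
  linarith

end Weight

/-! ### Geometric convolutions and the dyadic Hardy inequality. -/

theorem rpow_tsum_mul_le {ι : Type*} {p : ℝ} (hp : 1 ≤ p) (θ a : ι → ℝ≥0∞) :
    (∑' i, θ i * a i) ^ p ≤ (∑' i, θ i) ^ (p - 1) * ∑' i, θ i * a i ^ p := by
  have hp0 : 0 < p := by linarith
  have h1 : ∑' i, θ i * a i ≤ (∑' i, θ i) ^ (1 - p⁻¹) * (∑' i, θ i * a i ^ p) ^ p⁻¹ := by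
    rw [ENNReal.tsum_eq_iSup_sum]
    refine iSup_le fun s => (ENNReal.inner_le_weight_mul_Lp_of_nonneg s hp θ a).trans ?_
    have : 0 ≤ 1 - p⁻¹ := sub_nonneg.2 (inv_le_one_of_one_le₀ hp)
    gcongr <;> exact ENNReal.sum_le_tsum s
  refine (ENNReal.rpow_le_rpow h1 hp0.le).trans_eq ?_
  rw [ENNReal.mul_rpow_of_nonneg _ _ hp0.le, ← ENNReal.rpow_mul, ← ENNReal.rpow_mul,
    inv_mul_cancel₀ hp0.ne', ENNReal.rpow_one]
  congr 2
  field_simp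

/-- Young's inequality for the convolution with a geometric sequence. -/
theorem tsum_rpow_tsum_geometric_le {p : ℝ} (hp : 1 ≤ p) (θ : ℝ≥0∞) (a : ℤ → ℝ≥0∞) :
    ∑' n : ℤ, (∑' k : ℕ, θ ^ k * a (n - k)) ^ p ≤ ((1 - θ)⁻¹) ^ p * ∑' n, a n ^ p := by
  have hp0 : 0 < p := by linarith
  calc ∑' n : ℤ, (∑' k : ℕ, θ ^ k * a (n - k)) ^ p
      ≤ ∑' n : ℤ, ((1 - θ)⁻¹) ^ (p - 1) * ∑' k : ℕ, θ ^ k * a (n - k) ^ p := by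
        refine ENNReal.tsum_le_tsum fun n => ?_
        rw [← ENNReal.tsum_geometric]
        exact rpow_tsum_mul_le hp _ _
    _ = ((1 - θ)⁻¹) ^ (p - 1) * ∑' k : ℕ, θ ^ k * ∑' n : ℤ, a n ^ p := by
        rw [ENNReal.tsum_mul_left, ENNReal.tsum_comm]
        congr 2
        ext k
        rw [ENNReal.tsum_mul_left]
        congr 1
        exact (Equiv.subRight (k : ℤ)).tsum_eq fun n => a n ^ p
    _ = ((1 - θ)⁻¹) ^ p * ∑' n, a n ^ p := by
        rw [ENNReal.tsum_mul_right, ENNReal.tsum_geometric, ← mul_assoc]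
        congr 1
        conv_lhs => rw [← ENNReal.rpow_one (1 - θ)⁻¹]
        rw [← ENNReal.rpow_mul, ← ENNReal.rpow_add_of_nonneg _ _ (by linarith) (by simp)]
        congr 1
        ring

theorem Ioc_zero_zpow_subset_iUnion (n : ℤ) :
    Ioc (0 : ℝ) (2 ^ (n + 1)) ⊆ ⋃ k : ℕ, Ioc ((2 : ℝ) ^ (n - k)) (2 ^ (n - k + 1)) := by
  rintro x ⟨hx0, hx⟩
  obtain ⟨m, hm⟩ := exists_mem_Ioc_zpow hx0 (one_lt_two (α := ℝ))
  have hmn : m < n + 1 := (zpow_lt_zpow_iff_right₀ (one_lt_two (α := ℝ))).1 (hm.1.trans_le hx)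
  refine mem_iUnion.2 ⟨(n - m).toNat, ?_⟩
  rwa [Int.toNat_of_nonneg (by omega), sub_sub_cancel]

/-- The dyadic form of Hardy's inequality for an `A_p` weight. -/
theorem exists_hardy {p : ℝ} (hp : 1 < p) (M : ℝ≥0) :
    ∃ C : ℝ≥0, ∀ w : ℝ → ℝ≥0, IsMuckenhoupt p w → apConst p w ≤ M →
      ∀ g : ℝ → ℝ≥0∞, AEMeasurable g (volume.restrict (Ioi 0)) →
      ∑' n : ℤ, (∫⁻ s in Ioc (0 : ℝ) (2 ^ (n + 1)), (w s : ℝ≥0∞)) *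
        ((ENNReal.ofReal (2 ^ n))⁻¹ * ∫⁻ s in Ioc (0 : ℝ) (2 ^ (n + 1)), g s) ^ p ≤
      C * ∫⁻ s in Ioi 0, g s ^ p * w s := by
  have hp0 : 0 < p := by linarith
  have hp1 : 0 < p - 1 := by linarith
  obtain ⟨ρ, hρ, hdouble⟩ := exists_dual_reverse_doubling hp M
  -- The dual mass enters Hölder's inequality with exponent `(p-1)/p`, so each halving of the
  -- interval gains this factor.
  set θ : ℝ≥0 := ρ ^ ((p - 1) / p)
  have hθ : θ < 1 := NNReal.rpow_lt_one hρ (by positivity)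
  refine ⟨M * 2 ^ p * ((1 - θ)⁻¹) ^ p, fun w hw hM g hg => ?_⟩
  set S : ℤ → ℝ≥0∞ := fun n => ∫⁻ s in Ioc (0 : ℝ) (2 ^ n), (w s : ℝ≥0∞) ^ (-(1 / (p - 1)))
  set A : ℤ → ℝ≥0∞ := fun n => ∫⁻ s in Ioc ((2 : ℝ) ^ n) (2 ^ (n + 1)), g s ^ p * w s
  have hpow (n : ℤ) : (0 : ℝ) < 2 ^ n := zpow_pos two_pos n
  have hS (n : ℤ) (k : ℕ) : S (n - k) ≤ ρ ^ k * S n := by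
    induction k with
    | zero => simp
    | succ k ih =>
      have := hdouble w hw hM (2 ^ (n - (k + 1 : ℕ))) (hpow _)
      rw [← zpow_one_add₀ two_ne_zero,
        show 1 + (n - (k + 1 : ℕ)) = n - k by push_cast; ring] at this
      calc S (n - (k + 1 : ℕ)) ≤ ρ * S (n - k) := this
        _ ≤ ρ * (ρ ^ k * S n) := by gcongr
        _ = _ := by rw [pow_succ]; ring
  have hI (n : ℤ) : ∫⁻ s in Ioc ((2 : ℝ) ^ n) (2 ^ (n + 1)), g s ≤
      A n ^ (1 / p) * S (n + 1) ^ ((p - 1) / p) := by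
    have h := rpow_lintegral_le_mul_rpow (μ := volume.restrict (Ioc ((2 : ℝ) ^ n) (2 ^ (n + 1)))) hp
      hw.measurable (ae_restrict_of_ae hw.ae_pos) (g := g)
      (hg.mono_set fun x hx => (hpow n).trans hx.1)
    have h' := ENNReal.rpow_le_rpow h (by positivity : 0 ≤ 1 / p)
    rw [ENNReal.mul_rpow_of_nonneg _ _ (by positivity), ← ENNReal.rpow_mul, ← ENNReal.rpow_mul,
      mul_one_div_cancel hp0.ne', ENNReal.rpow_one, mul_one_div] at h'
    refine h'.trans ?_
    gcongr
    exact lintegral_mono_set (Ioc_subset_Ioc_left (hpow n).le)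
  have hB (n : ℤ) : ∫⁻ s in Ioc (0 : ℝ) (2 ^ (n + 1)), g s ≤
      S (n + 1) ^ ((p - 1) / p) * ∑' k : ℕ, (θ : ℝ≥0∞) ^ k * A (n - k) ^ (1 / p) := by
    rw [← ENNReal.tsum_mul_left]
    calc _ ≤ ∑' k : ℕ, ∫⁻ s in Ioc ((2 : ℝ) ^ (n - k)) (2 ^ (n - k + 1)), g s :=
          (lintegral_mono_set (Ioc_zero_zpow_subset_iUnion n)).trans (lintegral_iUnion_le _ _)
      _ ≤ _ := by
        refine ENNReal.tsum_le_tsum fun k => (hI _).trans ?_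
        rw [show n - k + 1 = n + 1 - k by ring]
        calc A (n - k) ^ (1 / p) * S (n + 1 - k) ^ ((p - 1) / p)
            ≤ A (n - k) ^ (1 / p) * (ρ ^ k * S (n + 1)) ^ ((p - 1) / p) := by gcongr; exact hS _ _
          _ = _ := by
            rw [ENNReal.mul_rpow_of_nonneg _ _ (by positivity), ← ENNReal.rpow_natCast,
              ← ENNReal.rpow_mul, mul_comm (k : ℝ), ENNReal.rpow_mul, ENNReal.rpow_natCast,
              ← ENNReal.coe_rpow_of_nonneg _ (by positivity)]
            ring
  -- The `A_p` bound on `(0, 2^(n+1)]` absorbs the dual mass factored out in `hB`. The powers of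
  -- `2^n` cancel and leave `M 2^p`.
  have hterm (n : ℤ) : (∫⁻ s in Ioc (0 : ℝ) (2 ^ (n + 1)), (w s : ℝ≥0∞)) *
        ((ENNReal.ofReal (2 ^ n))⁻¹ * ∫⁻ s in Ioc (0 : ℝ) (2 ^ (n + 1)), g s) ^ p ≤
      M * 2 ^ p * (∑' k : ℕ, (θ : ℝ≥0∞) ^ k * A (n - k) ^ (1 / p)) ^ p := by
    have hW := lintegral_mul_rpow_le_of_apConst_le hp hM (hpow (n + 1))
    set V := ∫⁻ s in Ioc (0 : ℝ) (2 ^ (n + 1)), (w s : ℝ≥0∞)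
    set Y := ∑' k : ℕ, (θ : ℝ≥0∞) ^ k * A (n - k) ^ (1 / p)
    set τ := ENNReal.ofReal (2 ^ n)
    have hτ0 : τ ≠ 0 := by simpa [τ] using hpow n
    have hτ : τ ^ p ≠ 0 := by simp [hτ0, τ]
    have hτ' : τ ^ p ≠ ∞ := ENNReal.rpow_ne_top_of_nonneg hp0.le ENNReal.ofReal_ne_top
    calc _ ≤ V * (τ⁻¹ * (S (n + 1) ^ ((p - 1) / p) * Y)) ^ p := by gcongr; exact hB n
      _ = (V * S (n + 1) ^ (p - 1)) * ((τ ^ p)⁻¹ * Y ^ p) := by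
        rw [ENNReal.mul_rpow_of_nonneg _ _ hp0.le, ENNReal.mul_rpow_of_nonneg _ _ hp0.le,
          ← ENNReal.rpow_mul, div_mul_cancel₀ _ hp0.ne', ENNReal.inv_rpow]
        ring
      _ ≤ (M * ENNReal.ofReal (2 ^ (n + 1)) ^ p) * ((τ ^ p)⁻¹ * Y ^ p) := by gcongr
      _ = M * 2 ^ p * (τ ^ p * (τ ^ p)⁻¹) * Y ^ p := by
        rw [zpow_add_one₀ two_ne_zero, ENNReal.ofReal_mul (hpow n).le, ENNReal.ofReal_ofNat,
          ENNReal.mul_rpow_of_nonneg _ _ hp0.le]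
        ring
      _ = _ := by rw [ENNReal.mul_inv_cancel hτ hτ', mul_one]
  have hsum : ∑' n, A n ≤ ∫⁻ s in Ioi 0, g s ^ p * w s := by
    have hmono : Monotone fun n : ℤ => (2 : ℝ) ^ n := zpow_right_mono₀ one_le_two
    have hdisj := hmono.pairwise_disjoint_on_Ioc_succ
    simp only [Order.succ_eq_add_one] at hdisj
    rw [← lintegral_iUnion (fun n => measurableSet_Ioc) hdisj]
    exact lintegral_mono_set (iUnion_subset fun n x hx => (hpow n).trans hx.1)
  calc _ ≤ ∑' n : ℤ, M * 2 ^ p * (∑' k : ℕ, (θ : ℝ≥0∞) ^ k * A (n - k) ^ (1 / p)) ^ p :=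
        ENNReal.tsum_le_tsum hterm
    _ ≤ M * 2 ^ p * (((1 - θ : ℝ≥0∞)⁻¹) ^ p * ∑' n, (A n ^ (1 / p)) ^ p) := by
        rw [ENNReal.tsum_mul_left]
        gcongr
        exact tsum_rpow_tsum_geometric_le hp.le _ fun n => A n ^ (1 / p)
    _ = M * 2 ^ p * ((1 - θ : ℝ≥0∞)⁻¹) ^ p * ∑' n, A n := by
        simp_rw [← ENNReal.rpow_mul, one_div_mul_cancel hp0.ne', ENNReal.rpow_one, mul_assoc]
    _ ≤ (M * 2 ^ p * ((1 - θ : ℝ≥0∞)⁻¹) ^ p) * ∫⁻ s in Ioi 0, g s ^ p * w s := by gcongr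
    _ = _ := by
        congr 1
        have h1 : (1 - θ : ℝ≥0) ≠ 0 := (tsub_pos_of_lt hθ).ne'
        push_cast [ENNReal.coe_rpow_of_nonneg _ hp0.le, ENNReal.coe_inv h1]
        rfl

/-! ### Growth of the kernel, its levels and its convolutions. -/

theorem le_mul_of_dilationSup_le {φ : ℝ → ℝ} (hpos : ∀ t, 0 < t → 0 < φ t) {r c : ℝ} (hc : 0 ≤ c)
    (h : dilationSup φ r ≤ ENNReal.ofReal c) {t : ℝ} (ht : 0 < t) : φ (r * t) ≤ c * φ t := by
  have h1 : ENNReal.ofReal (φ (r * t) / φ t) ≤ ENNReal.ofReal c :=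
    (le_iSup₂ (f := fun (t : ℝ) (_ : 0 < t) => ENNReal.ofReal (φ (r * t) / φ t)) t ht).trans h
  rwa [ENNReal.ofReal_le_ofReal_iff hc, div_le_iff₀ (hpos t ht)] at h1

section Kernel

variable {κ : ℝ → ℝ}

theorem IsClassIo.exists_contraction_zero (hκ : IsClassIo (-1) 0 κ) :
    ∃ r : ℝ, 0 < r ∧ r < 1 / 2 ∧ ∀ t, 0 < t → κ (r * t) ≤ (2 * r)⁻¹ * κ t := by
  have h1 := hκ.isLittleO_zero.eventually_le_const (ENNReal.ofReal_pos.2 (one_half_pos (α := ℝ)))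
  have h2 : ∀ᶠ r : ℝ in 𝓝[>] 0, r ∈ Ioo (0 : ℝ) (1 / 2) := Ioo_mem_nhdsGT (by norm_num)
  obtain ⟨r, hr, hr0, hr1⟩ := (h1.and h2).exists
  refine ⟨r, hr0, hr1, fun t ht => le_mul_of_dilationSup_le hκ.pos (by positivity) ?_ ht⟩
  rw [ENNReal.div_le_iff_le_mul (by simp [Real.rpow_neg_one, hr0]) (by simp),
    ← ENNReal.ofReal_mul (by norm_num), Real.rpow_neg_one] at hr
  rwa [mul_inv, inv_eq_one_div 2]

theorem IsClassIo.exists_contraction_top (hκ : IsClassIo (-1) 0 κ) :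
    ∃ R : ℝ, 1 < R ∧ ∀ t, 0 < t → κ (R * t) ≤ 1 / 2 * κ t := by
  have h1 := hκ.isLittleO_top.eventually_le_const (ENNReal.ofReal_pos.2 (one_half_pos (α := ℝ)))
  obtain ⟨R, hR, hR1⟩ := (h1.and (eventually_gt_atTop 1)).exists
  refine ⟨R, hR1, fun t ht => le_mul_of_dilationSup_le hκ.pos (by norm_num) ?_ ht⟩
  simpa using hR

theorem Ioc_zero_subset_iUnion_pow {r t : ℝ} (hr0 : 0 < r) (hr1 : r < 1) :
    Ioc 0 t ⊆ ⋃ n : ℕ, Ioc (r ^ (n + 1) * t) (r ^ n * t) := by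
  rintro x ⟨hx0, hxt⟩
  have ht : 0 < t := hx0.trans_le hxt
  obtain ⟨n, h1, h2⟩ := exists_nat_pow_near_of_lt_one (div_pos hx0 ht) ((div_le_one ht).2 hxt)
    hr0 hr1
  exact mem_iUnion.2 ⟨n, (lt_div_iff₀ ht).1 h1, (div_le_iff₀ ht).1 h2⟩

/-- Take `r < 1/2` with `κ(r t) ≤ (2r)⁻¹ κ(t)`, and `C = r⁻¹`. Doubling follows from `r · 2t ≤ t`.
On `(r^(n+1) t, r^n t]` the integral is at most `(2r)^(-(n+1)) κ(t) · r^n t = r⁻¹ t κ(t)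
2^(-(n+1))`, which sums to `C t κ(t)`. -/
theorem IsClassIo.exists_lintegral_le (hκ : IsClassIo (-1) 0 κ) (hanti : AntitoneOn κ (Ioi 0)) :
    ∃ C : ℝ, 1 ≤ C ∧ (∀ t, 0 < t → κ t ≤ C * κ (2 * t)) ∧
      ∀ t, 0 < t → ∫⁻ s in Ioc 0 t, ENNReal.ofReal (κ s) ≤ ENNReal.ofReal (C * (t * κ t)) := by
  obtain ⟨r, hr0, hr, h⟩ := hκ.exists_contraction_zero
  refine ⟨r⁻¹, (one_le_inv₀ hr0).2 (by linarith), fun t ht => ?_, fun t ht => ?_⟩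
  · have h1 : κ t ≤ κ (r * (2 * t)) :=
      hanti (mul_pos hr0 (by linarith) : (0 : ℝ) < _) ht (by nlinarith)
    refine h1.trans ((h _ (by linarith)).trans ?_)
    have := (hκ.pos (2 * t) (by linarith)).le
    gcongr
    linarith
  have hpow (n : ℕ) : κ (r ^ n * t) ≤ ((2 * r)⁻¹) ^ n * κ t := by
    induction n with
    | zero => simp
    | succ n ih =>
      calc κ (r ^ (n + 1) * t) = κ (r * (r ^ n * t)) := by ring_nf
        _ ≤ (2 * r)⁻¹ * κ (r ^ n * t) := h _ (by positivity)
        _ ≤ (2 * r)⁻¹ * (((2 * r)⁻¹) ^ n * κ t) := by gcongr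
        _ = _ := by ring
  have hκt := (hκ.pos t ht).le
  have hsum : HasSum (fun n : ℕ => r⁻¹ * (t * κ t) * (1 / 2 / 2 ^ n)) (r⁻¹ * (t * κ t)) := by
    simpa using (hasSum_geometric_two' 1).mul_left (r⁻¹ * (t * κ t))
  calc ∫⁻ s in Ioc 0 t, ENNReal.ofReal (κ s)
      ≤ ∑' n : ℕ, ∫⁻ s in Ioc (r ^ (n + 1) * t) (r ^ n * t), ENNReal.ofReal (κ s) :=
        (lintegral_mono_set (Ioc_zero_subset_iUnion_pow hr0 (by linarith))).trans
          (lintegral_iUnion_le _ _)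
    _ ≤ ∑' n : ℕ, ENNReal.ofReal (r⁻¹ * (t * κ t) * (1 / 2 / 2 ^ n)) := by
        refine ENNReal.tsum_le_tsum fun n => ?_
        calc _ ≤ ∫⁻ s in Ioc (r ^ (n + 1) * t) (r ^ n * t),
              ENNReal.ofReal (((2 * r)⁻¹) ^ (n + 1) * κ t) := by
              refine setLIntegral_mono measurable_const fun s hs => ENNReal.ofReal_le_ofReal ?_
              have h0 : 0 < r ^ (n + 1) * t := by positivity
              exact (hanti h0 (h0.trans hs.1) hs.1.le).trans (hpow _)
          _ = ENNReal.ofReal (((2 * r)⁻¹) ^ (n + 1) * κ t * (r ^ n * t - r ^ (n + 1) * t)) := by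
              rw [setLIntegral_const, Real.volume_Ioc, ← ENNReal.ofReal_mul (by positivity)]
          _ ≤ ENNReal.ofReal (((2 * r)⁻¹) ^ (n + 1) * κ t * (r ^ n * t)) := by
              gcongr
              linarith [show 0 ≤ r ^ (n + 1) * t by positivity]
          _ = _ := by
              congr 1
              rw [inv_pow, mul_pow]
              field_simp
              ring
    _ = ENNReal.ofReal (r⁻¹ * (t * κ t)) := by
        rw [← ENNReal.ofReal_tsum_of_nonneg (fun n => by positivity) hsum.summable, hsum.tsum_eq]

/-- Dilation by some `R > 1` at least halves `κ`, so `κ` takes values above and below any level. The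
last `n` with `l < κ(2^n)` then works; jumps of `κ` do no harm. -/
theorem IsClassIo.exists_dyadic_mem_Icc (hκ : IsClassIo (-1) 0 κ) (hanti : AntitoneOn κ (Ioi 0))
    {l : ℝ} (hl : 0 < l) : ∃ n : ℤ, l ∈ Icc (κ (2 ^ (n + 1))) (κ (2 ^ n)) := by
  obtain ⟨R, hR, h⟩ := hκ.exists_contraction_top
  have hR0 : 0 < R := by linarith
  have hdown (k : ℕ) : κ (R ^ k) ≤ (1 / 2) ^ k * κ 1 := by
    induction k with
    | zero => simp
    | succ k ih =>
      rw [pow_succ', pow_succ']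
      linarith [h _ (pow_pos hR0 k)]
  have hup (k : ℕ) : κ 1 ≤ (1 / 2) ^ k * κ ((R ^ k)⁻¹) := by
    induction k with
    | zero => simp
    | succ k ih =>
      have := h (R ^ (k + 1))⁻¹ (by positivity)
      rw [pow_succ', mul_inv, mul_inv_cancel_left₀ hR0.ne', ← mul_inv] at this
      calc _ ≤ _ := ih
        _ ≤ (1 / 2) ^ k * (1 / 2 * κ (R * R ^ k)⁻¹) := by gcongr
        _ = _ := by rw [pow_succ, ← pow_succ']; ring
  have hκ1 := hκ.pos 1 one_pos
  have hlim : Tendsto (fun k : ℕ => (1 / 2 : ℝ) ^ k) atTop (𝓝 0) :=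
    tendsto_pow_atTop_nhds_zero_of_lt_one (by norm_num) (by norm_num)
  have hsmall : ∃ t, 0 < t ∧ κ t ≤ l := by
    obtain ⟨k, hk⟩ := ((hlim.mul_const (κ 1)).eventually_le_const (by simpa using hl)).exists
    exact ⟨R ^ k, by positivity, (hdown k).trans hk⟩
  have hlarge : ∃ t, 0 < t ∧ l < κ t := by
    obtain ⟨k, hk⟩ := ((hlim.mul_const l).eventually_lt_const (by simpa using hκ1)).exists
    exact ⟨(R ^ k)⁻¹, by positivity, lt_of_mul_lt_mul_left (hk.trans_le (hup k)) (by positivity)⟩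
  obtain ⟨a, ha, hal⟩ := hsmall
  obtain ⟨b, hb, hbl⟩ := hlarge
  obtain ⟨N, hN⟩ := exists_mem_Ico_zpow ha (one_lt_two (α := ℝ))
  obtain ⟨m, hm⟩ := exists_mem_Ico_zpow hb (one_lt_two (α := ℝ))
  have hpow (n : ℤ) : (0 : ℝ) < 2 ^ n := zpow_pos two_pos n
  obtain ⟨n, hn, hub⟩ := Int.exists_greatest_of_bdd (P := fun n : ℤ => l < κ (2 ^ n))
    ⟨N + 1, fun z hz => by
      by_contra! hlt
      refine hz.not_ge ((hanti ha (hpow z) ?_).trans hal)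
      exact hN.2.le.trans (zpow_le_zpow_right₀ one_le_two hlt.le)⟩
    ⟨m, hbl.trans_le (hanti (hpow m) hb hm.1)⟩
  refine ⟨n, ?_, hn.le⟩
  by_contra! hlt
  have := hub _ hlt
  omega

theorem lintegral_inv_Icc_le {a b : ℝ} (ha : 0 < a) :
    ∫⁻ l in Icc a b, ENNReal.ofReal l⁻¹ ≤ ENNReal.ofReal (b / a) := by
  calc _ ≤ ∫⁻ l in Icc a b, ENNReal.ofReal a⁻¹ := by
        refine setLIntegral_mono measurable_const fun l hl => ENNReal.ofReal_le_ofReal ?_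
        exact inv_anti₀ ha hl.1
    _ = ENNReal.ofReal (a⁻¹ * (b - a)) := by
        rw [setLIntegral_const, Real.volume_Icc, ENNReal.ofReal_mul (by positivity)]
    _ ≤ _ := by
        rw [div_eq_inv_mul]
        gcongr
        linarith

theorem genInv_le {l t : ℝ} (ht : 0 < t) (h : κ t ≤ l) : genInv κ l ≤ t :=
  csInf_le ⟨0, fun _ hs => hs.1.le⟩ ⟨ht, h⟩

theorem genInv_nonneg (l : ℝ) : 0 ≤ genInv κ l :=
  Real.sInf_nonneg fun _ hs => hs.1.le

/-- Extended by `∞` to `(-∞, 0]`, the kernel is antitone on the whole line, hence Borel. -/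
theorem measurable_indicator_of_antitoneOn (hanti : AntitoneOn κ (Ioi 0)) :
    Measurable ((Ioi (0 : ℝ)).indicator fun s => ENNReal.ofReal (κ s)) := by
  have h : Antitone fun s : ℝ => if 0 < s then ENNReal.ofReal (κ s) else ∞ := by
    intro a b hab
    rcases lt_or_ge 0 a with ha | ha
    · have hb := ha.trans_le hab
      simp only [ha, hb, if_true]
      exact ENNReal.ofReal_le_ofReal (hanti ha hb hab)
    · simp [ha.not_gt]
  convert h.measurable.indicator (measurableSet_Ioi (a := (0 : ℝ))) using 1
  refine indicator_congr fun s hs => ?_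
  simp [mem_Ioi.1 hs]

/-- The mean over `(T, 2T]` of a convolution on the half-line. -/
theorem lintegral_lintegral_convolution_le {k g : ℝ → ℝ≥0∞} (hk : Measurable k)
    (hk0 : ∀ s ≤ 0, k s = 0) {T : ℝ} (hg : AEMeasurable g (volume.restrict (Ioc 0 (2 * T)))) :
    ∫⁻ t in Ioc T (2 * T), ∫⁻ s in Ioc 0 (2 * T), k (t - s) * g s ≤
      (∫⁻ s in Ioc 0 (2 * T), k s) * ∫⁻ s in Ioc 0 (2 * T), g s := by
  -- After Tonelli, translation by `s > 0` places the support of `k(t - s)`, `t ≤ 2T`, inside `(0,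
  -- 2T]`.
  rw [lintegral_lintegral_swap]
  · rw [← lintegral_const_mul'' _ hg]
    refine setLIntegral_mono_ae' measurableSet_Ioc (Eventually.of_forall fun s hs => ?_)
    rw [lintegral_mul_const _ (by fun_prop)]
    refine mul_le_mul' ?_ le_rfl
    rw [← lintegral_indicator measurableSet_Ioc, ← lintegral_indicator measurableSet_Ioc,
      ← lintegral_sub_right_eq_self (fun t => (Ioc 0 (2 * T)).indicator k t) s]
    refine lintegral_mono fun t => ?_
    by_cases ht : t ∈ Ioc T (2 * T)
    · rw [indicator_of_mem ht]
      rcases le_or_gt (t - s) 0 with h | h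
      · simp [hk0 _ h]
      · rw [indicator_of_mem (show t - s ∈ Ioc 0 (2 * T) from ⟨h, by linarith [ht.2, hs.1]⟩)]
    · rw [indicator_of_notMem ht]
      exact zero_le
  · exact (hk.comp (measurable_fst.sub measurable_snd)).aemeasurable.mul hg.comp_snd

end Kernel

/-! ### The pointwise bound for the `K`-functional. -/

namespace InterpolationCouple

variable {X₀ X₁ Z : Type*}
  [NormedAddCommGroup X₀] [NormedSpace ℝ X₀] [NormedAddCommGroup X₁] [NormedSpace ℝ X₁]
  [AddCommGroup Z] [Module ℝ Z] [TopologicalSpace Z] [IsTopologicalAddGroup Z]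
  [ContinuousSMul ℝ Z] [T2Space Z]

/-- The inclusion of `X₀` in `X₀ + X₁` as a continuous linear map. -/
noncomputable def inlL (c : InterpolationCouple X₀ X₁ Z) : X₀ →L[ℝ] c.SumSpace :=
  LinearMap.mkContinuous
    { toFun := c.inl
      map_add' := fun a b => by
        apply c.toAmbient_injective
        simp [inl, toAmbient, addMap]
      map_smul' := fun r a => by
        apply c.toAmbient_injective
        simp [inl, toAmbient, addMap] } 1
    fun a => (Submodule.Quotient.norm_mk_le c.addKer _).trans (by simp)

/-- The inclusion of `X₁` in `X₀ + X₁` as a continuous linear map. -/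
noncomputable def inrL (c : InterpolationCouple X₀ X₁ Z) : X₁ →L[ℝ] c.SumSpace :=
  LinearMap.mkContinuous
    { toFun := c.inr
      map_add' := fun a b => by
        apply c.toAmbient_injective
        simp [inr, toAmbient, addMap]
      map_smul' := fun r a => by
        apply c.toAmbient_injective
        simp [inr, toAmbient, addMap] } 1
    fun a => (Submodule.Quotient.norm_mk_le c.addKer _).trans (by simp)

@[simp] theorem inlL_apply (c : InterpolationCouple X₀ X₁ Z) (a : X₀) : c.inlL a = c.inl a := rfl

@[simp] theorem inrL_apply (c : InterpolationCouple X₀ X₁ Z) (a : X₁) : c.inrL a = c.inr a := rfl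

theorem kFunctional_mono (c : InterpolationCouple X₀ X₁ Z) {s t : ℝ} (hst : s ≤ t)
    (a : c.SumSpace) : c.kFunctional s a ≤ c.kFunctional t a := by
  unfold kFunctional
  gcongr

theorem kFunctional_le_of_smul_eq (c : InterpolationCouple X₀ X₁ Z) {a : c.SumSpace} {a₀ : X₀}
    {a₁ : X₁} {r l : ℝ} (hr : 0 < r) (hl : 0 ≤ l) (h : r • a = c.inl a₀ - c.inr a₁) :
    c.kFunctional l a ≤ ENNReal.ofReal r⁻¹ * (‖a₀‖ₑ + ENNReal.ofReal l * ‖a₁‖ₑ) := by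
  have ha : a = c.inl (r⁻¹ • a₀) + c.inr (-(r⁻¹ • a₁)) := by
    rw [← inlL_apply, ← inrL_apply, map_neg, map_smul, map_smul, ← sub_eq_add_neg, ← smul_sub,
      inlL_apply, inrL_apply, ← h, inv_smul_smul₀ hr.ne']
  refine (iInf₂_le_of_le _ _ (iInf_le_of_le ha le_rfl)).trans_eq ?_
  rw [norm_neg, norm_smul, norm_smul, Real.norm_of_nonneg (inv_pos.2 hr).le,
    show r⁻¹ * ‖a₀‖ + l * (r⁻¹ * ‖a₁‖) = r⁻¹ * (‖a₀‖ + l * ‖a₁‖) by ring,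
    ENNReal.ofReal_mul (inv_pos.2 hr).le, ENNReal.ofReal_add (norm_nonneg _) (by positivity),
    ENNReal.ofReal_mul hl, ofReal_norm, ofReal_norm]

variable [CompleteSpace X₀] [CompleteSpace X₁]

/-- The argument `κ(T)` balances the two parts of `u₀`: before division by `m = ∫_0^t κ`, the `X₀`
part is `≲ κ(T) J` and the `X₁` part is at most `J`. -/
theorem kFunctional_le_lintegral (c : InterpolationCouple X₀ X₁ Z) {κ : ℝ → ℝ}
    (hanti : AntitoneOn κ (Ioi 0)) (hpos : ∀ t, 0 < t → 0 < κ t) {C : ℝ} (hC : 1 ≤ C)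
    (hdouble : ∀ t, 0 < t → κ t ≤ C * κ (2 * t))
    (hint : ∀ t, 0 < t → ∫⁻ s in Ioc 0 t, ENNReal.ofReal (κ s) ≤ ENNReal.ofReal (C * (t * κ t)))
    {u : ℝ → X₀} {f : ℝ → X₁} {u₀ : c.SumSpace}
    (hu : AEStronglyMeasurable u (volume.restrict (Ioi 0)))
    (hf : AEStronglyMeasurable f (volume.restrict (Ioi 0)))
    (heq : ∀ᵐ t ∂(volume.restrict (Ioi (0 : ℝ))),
      ∫ s in (0 : ℝ)..t, κ (t - s) • (c.inl (u s) - u₀) = ∫ s in (0 : ℝ)..t, c.inr (f s))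
    {T : ℝ} (hT : 0 < T) :
    c.kFunctional (κ T) u₀ ≤ ENNReal.ofReal (C * (2 * C + 1)) *
      ((ENNReal.ofReal T)⁻¹ * ∫⁻ s in Ioc 0 (2 * T), (‖u s‖ₑ + ‖f s‖ₑ)) := by
  set J := ∫⁻ s in Ioc 0 (2 * T), (‖u s‖ₑ + ‖f s‖ₑ)
  have hC0 : 0 < C := by linarith
  rcases eq_or_ne J ∞ with hJ' | hJ'
  · rw [hJ', ENNReal.mul_top (by simp), ENNReal.mul_top (by simp; positivity)]
    exact le_top
  have hT2 : 0 < 2 * T := by linarith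
  have hsub : Ioc 0 (2 * T) ⊆ Ioi 0 := fun x hx => hx.1
  set k : ℝ → ℝ≥0∞ := (Ioi (0 : ℝ)).indicator fun s => ENNReal.ofReal (κ s) with hk
  have hkm : Measurable k := measurable_indicator_of_antitoneOn hanti
  have hkint : ∫⁻ s in Ioc 0 (2 * T), k s ≤ ENNReal.ofReal (C * (2 * T * κ T)) := by
    calc _ = ∫⁻ s in Ioc 0 (2 * T), ENNReal.ofReal (κ s) :=
          setLIntegral_congr_fun measurableSet_Ioc fun s hs => indicator_of_mem (hsub hs) _
      _ ≤ _ := hint _ hT2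
      _ ≤ _ := by
        gcongr
        exact hanti hT hT2 (by linarith)
  have hgm : AEMeasurable (fun s => ‖u s‖ₑ) (volume.restrict (Ioc 0 (2 * T))) :=
    (hu.mono_set hsub).enorm
  have hgJ : ∫⁻ s in Ioc 0 (2 * T), ‖u s‖ₑ ≤ J := lintegral_mono fun s => le_self_add
  set G : ℝ → ℝ≥0∞ := fun t => ∫⁻ s in Ioc 0 (2 * T), k (t - s) * ‖u s‖ₑ
  have hGint : ∫⁻ t in Ioc T (2 * T), G t ≤ ENNReal.ofReal (C * (2 * T * κ T)) * J :=
    (lintegral_lintegral_convolution_le hkm (fun s hs => indicator_of_notMem hs.not_gt _) hgm).trans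
      (by gcongr)
  have hGm : AEMeasurable G (volume.restrict (Ioc T (2 * T))) :=
    AEMeasurable.lintegral_prod_right' (f := fun z : ℝ × ℝ => k (z.1 - z.2) * ‖u z.2‖ₑ)
      ((hkm.comp (measurable_fst.sub measurable_snd)).aemeasurable.mul hgm.comp_snd)
  -- A function is at most its mean at some point outside any given null set, so the equation can be
  -- required at the same `t`.
  obtain ⟨t, ⟨htT, hteq⟩, htG⟩ : ∃ t, (t ∈ Ioc T (2 * T) ∧
      ∫ s in (0 : ℝ)..t, κ (t - s) • (c.inl (u s) - u₀) = ∫ s in (0 : ℝ)..t, c.inr (f s)) ∧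
      G t ≤ ENNReal.ofReal (2 * C * κ T) * J := by
    have hae : ∀ᵐ t ∂(volume.restrict (Ioc T (2 * T))), t ∈ Ioc T (2 * T) ∧
        ∫ s in (0 : ℝ)..t, κ (t - s) • (c.inl (u s) - u₀) = ∫ s in (0 : ℝ)..t, c.inr (f s) :=
      (ae_restrict_mem measurableSet_Ioc).and
        (ae_restrict_of_ae_restrict_of_subset (fun x hx => hT.trans hx.1) heq)
    have hvol : volume.restrict (Ioc T (2 * T)) ≠ 0 := by
      rw [Ne, Measure.restrict_eq_zero, Real.volume_Ioc, ENNReal.ofReal_eq_zero, not_le]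
      linarith
    obtain ⟨t, ht, htG⟩ := exists_notMem_null_le_laverage hvol hGm hae
    refine ⟨t, not_not.1 ht, htG.trans ?_⟩
    rw [setLAverage_eq, Real.volume_Ioc, show 2 * T - T = T by ring]
    refine ENNReal.div_le_of_le_mul (hGint.trans_eq ?_)
    rw [show C * (2 * T * κ T) = 2 * C * κ T * T by ring,
      ENNReal.ofReal_mul (by have := hpos T hT; positivity)]
    ring
  have ht0 : 0 < t := hT.trans htT.1
  have hsubt : Ioc 0 t ⊆ Ioc 0 (2 * T) := Ioc_subset_Ioc_right htT.2
  set ν := volume.restrict (Ioc 0 t) with hν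
  -- The endpoint `s = t` is discarded: nothing is known about `κ 0`.
  have hkt : ∀ᵐ s ∂ν, 0 < t - s ∧ t - s ≤ 2 * T := by
    rw [hν, ← restrict_Ioo_eq_restrict_Ioc]
    filter_upwards [ae_restrict_mem measurableSet_Ioo] with s hs
    exact ⟨by linarith [hs.2], by linarith [hs.1, htT.2]⟩
  have hmem : AEStronglyMeasurable (fun s => κ (t - s)) ν := by
    refine AEStronglyMeasurable.congr (f := fun s => (k (t - s)).toReal)
      (hkm.comp (measurable_const.sub measurable_id)).ennreal_toReal.aestronglyMeasurable ?_
    filter_upwards [hkt] with s hs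
    simp [hk, indicator_of_mem (mem_Ioi.2 hs.1), (hpos _ hs.1).le]
  have hk_eq : ∀ᵐ s ∂ν, ‖κ (t - s)‖ₑ = k (t - s) := by
    filter_upwards [hkt] with s hs
    rw [hk, indicator_of_mem (mem_Ioi.2 hs.1), Real.enorm_of_nonneg (hpos _ hs.1).le]
  have hκ_int : Integrable (fun s => κ (t - s)) ν := by
    refine ⟨hmem, ?_⟩
    rw [hasFiniteIntegral_iff_enorm, lintegral_congr_ae hk_eq]
    refine lt_of_le_of_lt ?_ (hkint.trans_lt ENNReal.ofReal_lt_top)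
    rw [hν, ← lintegral_indicator measurableSet_Ioc, ← lintegral_indicator measurableSet_Ioc,
      ← lintegral_sub_left_eq_self (fun s => (Ioc 0 (2 * T)).indicator k s) t]
    refine lintegral_mono fun s => ?_
    by_cases hs : s ∈ Ioc 0 t
    · rw [indicator_of_mem hs]
      rcases le_or_gt (t - s) 0 with h | h
      · simp [hk, h.not_gt]
      · rw [indicator_of_mem (show t - s ∈ Ioc 0 (2 * T) from ⟨h, by linarith [htT.2, hs.1]⟩)]
    · rw [indicator_of_notMem hs]
      exact zero_le
  have hu_lint : ∫⁻ s, ‖κ (t - s) • u s‖ₑ ∂ν ≤ G t := by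
    calc _ = ∫⁻ s, k (t - s) * ‖u s‖ₑ ∂ν := by
          refine lintegral_congr_ae ?_
          filter_upwards [hk_eq] with s hs
          rw [enorm_smul, hs]
      _ ≤ _ := lintegral_mono_set hsubt
  have hu_int : Integrable (fun s => κ (t - s) • u s) ν :=
    ⟨hmem.smul (hu.mono_set (hsubt.trans hsub)), hu_lint.trans_lt (htG.trans_lt
      (ENNReal.mul_lt_top ENNReal.ofReal_lt_top hJ'.lt_top))⟩
  have hf_lint : ∫⁻ s, ‖f s‖ₑ ∂ν ≤ J :=
    (lintegral_mono_set hsubt).trans (lintegral_mono fun s => le_add_self)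
  have hf_int : Integrable f ν :=
    ⟨hf.mono_set (hsubt.trans hsub), hf_lint.trans_lt hJ'.lt_top⟩
  -- With integrability known, the integrals may be taken in `X₀` and `X₁` themselves and the term
  -- in `u₀` split off.
  have hsplit : (∫ s, κ (t - s) ∂ν) • u₀ =
      c.inl (∫ s, κ (t - s) • u s ∂ν) - c.inr (∫ s, f s ∂ν) := by
    rw [intervalIntegral.integral_of_le ht0.le, intervalIntegral.integral_of_le ht0.le] at hteq
    rw [← inlL_apply, ← inrL_apply, ← c.inlL.integral_comp_comm hu_int,
      ← c.inrL.integral_comp_comm hf_int]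
    refine (integral_smul_const (μ := ν) (fun s => κ (t - s)) u₀).symm.trans ?_
    simp_rw [smul_sub] at hteq
    rw [integral_sub (by simpa using c.inlL.integrable_comp hu_int) (hκ_int.smul_const u₀)] at hteq
    simp only [map_smul, inlL_apply, inrL_apply]
    rw [← hteq]
    abel
  have hlow : T * κ T / C ≤ ∫ s, κ (t - s) ∂ν := by
    calc T * κ T / C ≤ T * κ (2 * T) := by
          rw [div_le_iff₀ hC0, mul_assoc, mul_comm (κ (2 * T))]
          exact mul_le_mul_of_nonneg_left (hdouble T hT) hT.le
      _ ≤ t * κ (2 * T) := mul_le_mul_of_nonneg_right htT.1.le (hpos _ hT2).le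
      _ = ∫ s, κ (2 * T) ∂ν := by simp [hν, ht0.le]
      _ ≤ _ := by
        refine integral_mono_ae (by simp [hν]) hκ_int ?_
        filter_upwards [hkt] with s hs
        exact hanti hs.1 hT2 hs.2
  have hκT := hpos T hT
  have hlow0 : 0 < T * κ T / C := by positivity
  calc c.kFunctional (κ T) u₀
      ≤ ENNReal.ofReal (∫ s, κ (t - s) ∂ν)⁻¹ *
        (‖∫ s, κ (t - s) • u s ∂ν‖ₑ + ENNReal.ofReal (κ T) * ‖∫ s, f s ∂ν‖ₑ) :=
        c.kFunctional_le_of_smul_eq (hlow0.trans_le hlow) hκT.le hsplit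
    -- The constant is `C / (T κ(T))` times `2C κ(T) + κ(T)`.
    _ ≤ ENNReal.ofReal (T * κ T / C)⁻¹ *
        (ENNReal.ofReal (2 * C * κ T) * J + ENNReal.ofReal (κ T) * J) := by
        gcongr
        · exact (enorm_integral_le_lintegral_enorm _).trans (hu_lint.trans htG)
        · exact (enorm_integral_le_lintegral_enorm _).trans hf_lint
    _ = _ := by
        rw [← add_mul, ← mul_assoc, ← mul_assoc, ← ENNReal.ofReal_inv_of_pos hT,
          ← ENNReal.ofReal_add (by positivity) hκT.le, ← ENNReal.ofReal_mul (by positivity),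
          ← ENNReal.ofReal_mul (by positivity)]
        congr 2
        field_simp

end InterpolationCouple

/-! ### Weighted norms and discretization of the interpolation norm. -/

section Weight

variable {p : ℝ} {w : ℝ → ℝ≥0}

theorem primitive_nonneg {t : ℝ} (ht : 0 ≤ t) : 0 ≤ primitive w t :=
  intervalIntegral.integral_nonneg ht fun _ _ => NNReal.coe_nonneg _

theorem ofReal_primitive_le (hw : Measurable w) {s t : ℝ} (hs : 0 ≤ s) (hst : s ≤ t) :
    ENNReal.ofReal (primitive w s) ≤ ∫⁻ r in Ioc 0 t, (w r : ℝ≥0∞) := by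
  rw [primitive, intervalIntegral.integral_of_le hs, integral_eq_lintegral_of_nonneg_ae
    (Eventually.of_forall fun _ => NNReal.coe_nonneg _)
    hw.coe_nnreal_real.aestronglyMeasurable]
  -- Only this inequality is needed, so integrability of `w` plays no role.
  refine ENNReal.ofReal_toReal_le.trans ?_
  simp only [ENNReal.ofReal_coe_nnreal]
  exact lintegral_mono_set (Ioc_subset_Ioc_right hst)

/-- Since `w > 0` almost everywhere, measurability of `u` and `f` passes from `w dt` to Lebesgue
measure. -/
theorem IsMuckenhoupt.absolutelyContinuous_halfLineMeasure (hw : IsMuckenhoupt p w) :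
    volume.restrict (Ioi 0) ≪ halfLineMeasure w :=
  withDensity_absolutelyContinuous' hw.measurable.coe_nnreal_ennreal.aemeasurable
    (ae_restrict_of_ae (hw.ae_pos.mono fun t ht => by exact_mod_cast ht.ne'))

theorem IsMuckenhoupt.rpow_lintegral_le_eLpNorm_add (hp : 1 < p) (hw : IsMuckenhoupt p w)
    {E F : Type*} [NormedAddCommGroup E] [NormedAddCommGroup F] {u : ℝ → E} {f : ℝ → F}
    (hu : AEStronglyMeasurable u (halfLineMeasure w))
    (hf : AEStronglyMeasurable f (halfLineMeasure w)) :
    (∫⁻ s in Ioi 0, (‖u s‖ₑ + ‖f s‖ₑ) ^ p * w s) ^ (1 / p) ≤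
      eLpNorm u (ENNReal.ofReal p) (halfLineMeasure w) +
        eLpNorm f (ENNReal.ofReal p) (halfLineMeasure w) := by
  have hp0 : 0 < p := by linarith
  have hac := hw.absolutelyContinuous_halfLineMeasure
  have hm : AEMeasurable (fun s => (‖u s‖ₑ + ‖f s‖ₑ) ^ p) (volume.restrict (Ioi 0)) :=
    ((hu.mono_ac hac).enorm.add (hf.mono_ac hac).enorm).pow_const p
  have h1 : ∫⁻ s in Ioi 0, (‖u s‖ₑ + ‖f s‖ₑ) ^ p * w s =
      ∫⁻ s, (‖u s‖ₑ + ‖f s‖ₑ) ^ p ∂(halfLineMeasure w) := by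
    rw [halfLineMeasure, lintegral_withDensity_eq_lintegral_mul₀
      hw.measurable.coe_nnreal_ennreal.aemeasurable hm]
    simp [mul_comm]
  rw [h1, eLpNorm_eq_lintegral_rpow_enorm_toReal (by simpa using hp0) ENNReal.ofReal_ne_top,
    eLpNorm_eq_lintegral_rpow_enorm_toReal (by simpa using hp0) ENNReal.ofReal_ne_top,
    ENNReal.toReal_ofReal hp0.le]
  exact ENNReal.lintegral_Lp_add_le hu.enorm hf.enorm hp.le

end Weight

/-- The interpolation norm is controlled by the values of the `K`-functional along the sequence
`κ (2 ^ n)`. -/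
theorem InterpolationCouple.rpow_interpNorm_le {X₀ X₁ Z : Type*}
    [NormedAddCommGroup X₀] [NormedSpace ℝ X₀] [NormedAddCommGroup X₁] [NormedSpace ℝ X₁]
    [AddCommGroup Z] [Module ℝ Z] [TopologicalSpace Z] [IsTopologicalAddGroup Z]
    [ContinuousSMul ℝ Z] [T2Space Z] (c : InterpolationCouple X₀ X₁ Z) {p : ℝ} (hp : 0 < p)
    {w : ℝ → ℝ≥0} (hw : Measurable w) {κ : ℝ → ℝ} (hκ : IsClassIo (-1) 0 κ)
    (hanti : AntitoneOn κ (Ioi 0)) {C : ℝ}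
    (hdouble : ∀ t, 0 < t → κ t ≤ C * κ (2 * t)) (a : c.SumSpace) :
    c.interpNorm (fun t => (primitive w (kStar κ t)) ^ (1 / p)) p a ^ p ≤
      ENNReal.ofReal C * ∑' n : ℤ, (∫⁻ s in Ioc (0 : ℝ) (2 ^ (n + 1)), (w s : ℝ≥0∞)) *
        c.kFunctional (κ (2 ^ n)) a ^ p := by
  have hpow (n : ℤ) : (0 : ℝ) < 2 ^ n := zpow_pos two_pos n
  have hsub : Ioi (0 : ℝ) ⊆ ⋃ n : ℤ, Icc (κ (2 ^ (n + 1))) (κ (2 ^ n)) := fun l hl =>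
    mem_iUnion.2 (hκ.exists_dyadic_mem_Icc hanti hl)
  rw [interpNorm, ← ENNReal.rpow_mul, one_div_mul_cancel hp.ne', ENNReal.rpow_one,
    ← ENNReal.tsum_mul_left]
  refine (lintegral_mono_set hsub).trans ((lintegral_iUnion_le _ _).trans ?_)
  refine ENNReal.tsum_le_tsum fun n => ?_
  have hκn : 0 < κ (2 ^ (n + 1)) := hκ.pos _ (hpow _)
  set V := ∫⁻ s in Ioc (0 : ℝ) (2 ^ (n + 1)), (w s : ℝ≥0∞)
  calc ∫⁻ l in Icc (κ (2 ^ (n + 1))) (κ (2 ^ n)),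
        (ENNReal.ofReal (primitive w (kStar κ l⁻¹) ^ (1 / p)) * c.kFunctional l a) ^ p *
          ENNReal.ofReal l⁻¹
      ≤ ∫⁻ l in Icc (κ (2 ^ (n + 1))) (κ (2 ^ n)),
        V * c.kFunctional (κ (2 ^ n)) a ^ p * ENNReal.ofReal l⁻¹ := by
        refine setLIntegral_mono (by fun_prop) fun l hl => ?_
        -- Here `κ*(1/l) = κ⁻¹(l)`, and `κ(2^(n+1)) ≤ l` forces `κ⁻¹(l) ≤ 2^(n+1)`.
        rw [kStar, one_div l⁻¹, inv_inv, ENNReal.mul_rpow_of_nonneg _ _ hp.le,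
          ← ENNReal.ofReal_rpow_of_nonneg (primitive_nonneg (genInv_nonneg l)) (by positivity),
          ← ENNReal.rpow_mul, one_div_mul_cancel hp.ne', ENNReal.rpow_one]
        gcongr
        · exact ofReal_primitive_le hw (genInv_nonneg l) (genInv_le (hpow _) hl.1)
        · exact c.kFunctional_mono hl.2 a
    _ = V * c.kFunctional (κ (2 ^ n)) a ^ p *
        ∫⁻ l in Icc (κ (2 ^ (n + 1))) (κ (2 ^ n)), ENNReal.ofReal l⁻¹ :=
        lintegral_const_mul _ (by fun_prop)
    _ ≤ V * c.kFunctional (κ (2 ^ n)) a ^ p * ENNReal.ofReal C := by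
        gcongr
        refine (lintegral_inv_Icc_le hκn).trans (ENNReal.ofReal_le_ofReal ?_)
        rw [div_le_iff₀ hκn, zpow_add_one₀ two_ne_zero, mul_comm _ (2 : ℝ)]
        exact hdouble _ (hpow n)
    _ = _ := mul_comm _ _

end VolterraTrace

/-! ### The trace theorem. -/

open VolterraTrace in
theorem theorem1p2 (p : ℝ) (hp : 1 < p) (κ : ℝ → ℝ)
    (hκ_anti : AntitoneOn κ (Ioi 0))
    (hκ_rc : ∀ t : ℝ, 0 < t → ContinuousWithinAt κ (Ici t) t)
    (hκ : IsClassIo (-1) 0 κ) (M : ℝ≥0) :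
    ∃ N : ℝ≥0, 0 < N ∧
      ∀ w : ℝ → ℝ≥0, IsMuckenhoupt p w → apConst p w ≤ M →
        IsClassIo 0 p (fun t => primitive w (kStar κ t)) →
        ∀ (X₀ X₁ Z : Type*)
          [NormedAddCommGroup X₀] [NormedSpace ℝ X₀] [CompleteSpace X₀]
          [NormedAddCommGroup X₁] [NormedSpace ℝ X₁] [CompleteSpace X₁]
          [AddCommGroup Z] [Module ℝ Z] [TopologicalSpace Z] [IsTopologicalAddGroup Z]
          [ContinuousSMul ℝ Z] [T2Space Z]
          (c : InterpolationCouple X₀ X₁ Z) (u : ℝ → X₀) (f : ℝ → X₁) (u₀ : c.SumSpace),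
          MemLp u (ENNReal.ofReal p) (halfLineMeasure w) →
          MemLp f (ENNReal.ofReal p) (halfLineMeasure w) →
          (∀ᵐ t ∂(volume.restrict (Ioi (0 : ℝ))),
            ∫ s in (0 : ℝ)..t, κ (t - s) • (c.inl (u s) - u₀) =
              ∫ s in (0 : ℝ)..t, c.inr (f s)) →
          u₀ ∈ c.interpSpace (fun t => (primitive w (kStar κ t)) ^ (1 / p)) p ∧
          c.interpNorm (fun t => (primitive w (kStar κ t)) ^ (1 / p)) p u₀ ≤
            N * (eLpNorm u (ENNReal.ofReal p) (halfLineMeasure w) +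
              eLpNorm f (ENNReal.ofReal p) (halfLineMeasure w)) := by
  have hp0 : 0 < p := by linarith
  obtain ⟨C, hC, hdouble, hint⟩ := hκ.exists_lintegral_le hκ_anti
  obtain ⟨H, hH⟩ := exists_hardy hp M
  set D : ℝ≥0 := (C * (2 * C + 1)).toNNReal
  set N₀ : ℝ≥0 := C.toNNReal * (D ^ p * H) with hN₀
  -- `N₀` bounds the `p`-th powers and involves only `C`, `p` and the Hardy constant; adding 1 makes
  -- positivity immediate.
  refine ⟨N₀ ^ (1 / p) + 1, by positivity, ?_⟩
  intro w hw hM _ X₀ X₁ Z _ _ _ _ _ _ _ _ _ _ _ _ c u f u₀ hu hf heq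
  have hac := hw.absolutelyContinuous_halfLineMeasure
  have hum := hu.aestronglyMeasurable.mono_ac hac
  have hfm := hf.aestronglyMeasurable.mono_ac hac
  set g : ℝ → ℝ≥0∞ := fun s => ‖u s‖ₑ + ‖f s‖ₑ
  have hK (n : ℤ) : c.kFunctional (κ (2 ^ n)) u₀ ≤
      D * ((ENNReal.ofReal (2 ^ n))⁻¹ * ∫⁻ s in Ioc (0 : ℝ) (2 ^ (n + 1)), g s) := by
    have := c.kFunctional_le_lintegral hκ_anti hκ.pos hC hdouble hint hum hfm heq
      (zpow_pos two_pos n)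
    rwa [← zpow_one_add₀ two_ne_zero, add_comm 1 n] at this
  have hmain : c.interpNorm (fun t => (primitive w (kStar κ t)) ^ (1 / p)) p u₀ ^ p ≤
      N₀ * ∫⁻ s in Ioi 0, g s ^ p * w s := by
    calc _ ≤ _ := c.rpow_interpNorm_le hp0 hw.measurable hκ hκ_anti hdouble u₀
      _ ≤ ENNReal.ofReal C * ∑' n : ℤ, (D : ℝ≥0∞) ^ p *
          ((∫⁻ s in Ioc (0 : ℝ) (2 ^ (n + 1)), (w s : ℝ≥0∞)) *
          ((ENNReal.ofReal (2 ^ n))⁻¹ * ∫⁻ s in Ioc (0 : ℝ) (2 ^ (n + 1)), g s) ^ p) := by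
          refine mul_le_mul' le_rfl (ENNReal.tsum_le_tsum fun n => ?_)
          rw [mul_left_comm, ← ENNReal.mul_rpow_of_nonneg _ _ hp0.le]
          gcongr
          exact hK n
      _ ≤ ENNReal.ofReal C * ((D : ℝ≥0∞) ^ p * (H * ∫⁻ s in Ioi 0, g s ^ p * w s)) := by
          rw [ENNReal.tsum_mul_left]
          gcongr
          exact hH w hw hM g (hum.enorm.add hfm.enorm)
      _ = _ := by
          rw [hN₀]
          push_cast [ENNReal.coe_rpow_of_nonneg _ hp0.le]
          rw [mul_assoc, mul_assoc]
          rfl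
  have hbound : c.interpNorm (fun t => (primitive w (kStar κ t)) ^ (1 / p)) p u₀ ≤
      (N₀ ^ (1 / p) + 1 : ℝ≥0) * (eLpNorm u (ENNReal.ofReal p) (halfLineMeasure w) +
        eLpNorm f (ENNReal.ofReal p) (halfLineMeasure w)) := by
    rw [← ENNReal.rpow_le_rpow_iff (by positivity : 0 < 1 / p), ← ENNReal.rpow_mul,
      mul_one_div_cancel hp0.ne', ENNReal.rpow_one,
      ENNReal.mul_rpow_of_nonneg _ _ (by positivity)] at hmain
    refine hmain.trans (mul_le_mul' ?_ (hw.rpow_lintegral_le_eLpNorm_add hp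
      hu.aestronglyMeasurable hf.aestronglyMeasurable))
    rw [← ENNReal.coe_rpow_of_nonneg _ (by positivity), ENNReal.coe_le_coe]
    exact le_self_add
  exact ⟨hbound.trans_lt (ENNReal.mul_lt_top ENNReal.coe_lt_top
    (ENNReal.add_lt_top.2 ⟨hu.eLpNorm_lt_top, hf.eLpNorm_lt_top⟩)), hbound⟩
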